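/- A metrized graph $\Gamma$ is a finite connected graph (self-loops, multiple edges and bridges allowed) with a non-empty finite vertex set $V(\Gamma)$ and finite edge set $E(\Gamma)$, in which each edge $e_i$ is a segment of length $L_i>0$ with end points $p_i,q_i\in V(\Gamma)$ ($p_i=q_i$ for a self-loop). Regard $\Gamma$ as an electric circuit in which each edge has resistance equal to its length. On a connected graph, let $j_z(x,y)$ be the voltage difference between $x$ and $z$ when unit current enters at $y$ and exits at $z$, and let $r(x,y)=j_y(x,x)$ be the effective resistance. For an edge $e_i$, let $\Gamma-e_i$ be $\Gamma$ with the interior of $e_i$ removed, and let $p\in V(\Gamma)$. If $\Gamma-e_i$ is connected, with voltage function $\hat j$ and resistance function $\hat r$, put $R_i=\hat r(p_i,q_i)$, $R_{a_i,p}=\hat j_{p_i}(p,q_i)$ and $R_{b_i,p}=\hat j_{q_i}(p,p_i)$. If $e_i$ is a bridge, i.e. $\Gamma-e_i$ is not connected, put $(R_{a_i,p},R_{b_i,p})=(0,R_i)$ if $p$ lies in the component of $\Gamma-e_i$ containing $p_i$, and $(R_{a_i,p},R_{b_i,p})=(R_i,0)$ otherwise, and read every expression in $R_i$ as its limit for $R_i\to\infty$.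 Define $$x(\Gamma)=\sum_{e_i\in E(\Gamma)}\frac{L_i^2R_i}{(L_i+R_i)^2}+\frac34\sum_{e_i\in E(\Gamma)}\frac{L_iR_i^2}{(L_i+R_i)^2}-\frac34\sum_{e_i\in E(\Gamma)}\frac{L_i(R_{a_i,p}-R_{b_i,p})^2}{(L_i+R_i)^2},$$ $$y(\Gamma)=\frac14\sum_{e_i\in E(\Gamma)}\frac{L_iR_i^2}{(L_i+R_i)^2}+\frac34\sum_{e_i\in E(\Gamma)}\frac{L_i(R_{a_i,p}-R_{b_i,p})^2}{(L_i+R_i)^2},$$ where $p$ is any vertex of $\Gamma$ (the values do not depend on it). Let $\overline{\Gamma}_i$ be the metrized graph obtained from $\Gamma$ by contracting the edge $e_i$ to a point, so that its end points are identified and all the other edges are kept with their lengths. **Theorem.** Let $\Gamma$ be a metrized graph with $v$ vertices. Then, whatever base vertices are used to compute the invariants of $\Gamma$ and of the $\overline{\Gamma}_i$, $$(v-2)\,x(\Gamma)=\sum_{e_i\in E(\Gamma)}\frac{R_i}{L_i+R_i}\,x(\overline{\Gamma}_i)\qquad\text{and}\qquad (v-2)\,y(\Gamma)=\sum_{e_i\in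 E(\Gamma)}\frac{R_i}{L_i+R_i}\,y(\overline{\Gamma}_i).$$ -/

import Mathlib

open Filter Topology

/-- A finite combinatorial model of a metrized graph together with a chosen vertex set: `V` is the
vertex set, `E` is the set of edges, and the edge `e` is a line segment of length `length e > 0`,
parametrized from the end point `src e` to the end point `tgt e`.  Self-loops (`src e = tgt e`) and
multiple edges are allowed.  Connectedness is the separate predicate `EdgeMetricGraph.Connected`,
because deleting an edge may destroy it; metrized graphs are the connected ones. -/
structure EdgeMetricGraph (V E : Type*) where
  /-- first end point of an edge -/
  src : E → V
  /-- second end point of an edge -/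
  tgt : E → V
  /-- length of an edge -/
  length : E → ℝ
  length_pos : ∀ e, 0 < length e

namespace EdgeMetricGraph

universe u v

variable {V : Type u} {E : Type v}

/-- Two vertices lie in the same connected component. -/
def Reachable (Γ : EdgeMetricGraph V E) : V → V → Prop :=
  Relation.EqvGen fun a b => ∃ e, Γ.src e = a ∧ Γ.tgt e = b

/-- The graph is non-empty and any two vertices are joined by a path of edges. -/
def Connected (Γ : EdgeMetricGraph V E) : Prop :=
  Nonempty V ∧ ∀ a b, Γ.Reachable a b

/-- `Γ - e`: the interior of the edge `e` is deleted, the vertices are kept. -/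
def delete (Γ : EdgeMetricGraph V E) (e : E) : EdgeMetricGraph V {f : E // f ≠ e} where
  src f := Γ.src f
  tgt f := Γ.tgt f
  length f := Γ.length f
  length_pos f := Γ.length_pos f

/-- The vertex set of the graph obtained by contracting `e`: the two end points of `e` are
identified, and nothing else is. -/
def ContractVertex (Γ : EdgeMetricGraph V E) (e : E) : Type u :=
  Quot fun a b : V => a = Γ.src e ∧ b = Γ.tgt e

instance (Γ : EdgeMetricGraph V E) (e : E) [Finite V] : Finite (Γ.ContractVertex e) :=
  inferInstanceAs (Finite (Quot fun a b : V => a = Γ.src e ∧ b = Γ.tgt e))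

/-- The graph obtained by contracting the edge `e` to its end points.  All the other edges
survive with their lengths; those parallel to `e` become self-loops. -/
def contract (Γ : EdgeMetricGraph V E) (e : E) :
    EdgeMetricGraph (Γ.ContractVertex e) {f : E // f ≠ e} where
  src f := Quot.mk _ (Γ.src f)
  tgt f := Quot.mk _ (Γ.tgt f)
  length f := Γ.length f
  length_pos f := Γ.length_pos f

/-- A contraction of a connected graph is connected. -/
theorem Connected.contract {Γ : EdgeMetricGraph V E} (h : Γ.Connected) (e : E) :
    (Γ.contract e).Connected := by
  obtain ⟨⟨a₀⟩, h⟩ := h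
  refine ⟨⟨Quot.mk _ a₀⟩, ?_⟩
  rintro ⟨a⟩ ⟨b⟩
  induction h a b with
  | rel a b hab =>
    obtain ⟨f, rfl, rfl⟩ := hab
    by_cases hf : f = e
    · subst hf
      have : (Quot.mk _ (Γ.src f) : Γ.ContractVertex f) = Quot.mk _ (Γ.tgt f) :=
        Quot.sound ⟨rfl, rfl⟩
      change (Γ.contract f).Reachable (Quot.mk _ (Γ.src f)) (Quot.mk _ (Γ.tgt f))
      rw [this]
      exact Relation.EqvGen.refl _
    · exact Relation.EqvGen.rel _ _ ⟨⟨f, hf⟩, rfl, rfl⟩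
  | refl a => exact Relation.EqvGen.refl _
  | symm a b _ ih => exact Relation.EqvGen.symm _ _ ih
  | trans a b c _ _ ih₁ ih₂ => exact Relation.EqvGen.trans _ _ _ ih₁ ih₂

/-- An edge whose deletion leaves a disconnected graph. -/
def IsBridge (Γ : EdgeMetricGraph V E) (e : E) : Prop := ¬ (Γ.delete e).Connected

section Voltage

variable [Fintype E]

open Classical in
/-- The total current that leaves the vertex `w` through the edges when the potential is `f` and
the resistance of each edge is its length (Ohm's law). -/
noncomputable def outflow (Γ : EdgeMetricGraph V E) (f : V → ℝ) (w : V) : ℝ :=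
  ∑ e with Γ.src e = w, (f w - f (Γ.tgt e)) / Γ.length e
    + ∑ e with Γ.tgt e = w, (f w - f (Γ.src e)) / Γ.length e

open Classical in
/-- `f` is the potential, with reference value `0` at `z`, when unit current enters at `y` and
exits at `z` (Kirchhoff's node law at every vertex). -/
def IsVoltage (Γ : EdgeMetricGraph V E) (z y : V) (f : V → ℝ) : Prop :=
  f z = 0 ∧ ∀ w, Γ.outflow f w = (if w = y then 1 else 0) - (if w = z then 1 else 0)

theorem sum_mul_outflow [Fintype V] (Γ : EdgeMetricGraph V E) (g f : V → ℝ) :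
    ∑ w, g w * Γ.outflow f w = ∑ e, (g (Γ.src e) - g (Γ.tgt e)) * (f (Γ.src e) - f (Γ.tgt e))
      / Γ.length e := by
  classical
  simp only [outflow, mul_add, Finset.sum_add_distrib, Finset.mul_sum, Finset.sum_filter]
  rw [Finset.sum_comm, Finset.sum_comm (f := fun w e => g w * if Γ.tgt e = w then _ else _),
    ← Finset.sum_add_distrib]
  refine Finset.sum_congr rfl fun e _ => ?_
  simp only [mul_ite, mul_zero, Finset.sum_ite_eq, Finset.mem_univ, if_true]
  ring

/-- On a connected graph the potential exists and is unique. -/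
theorem existsUnique_isVoltage [Finite V] {Γ : EdgeMetricGraph V E} (h : Γ.Connected) (z y : V) :
    ∃! f, Γ.IsVoltage z y f := by
  classical
  cases nonempty_fintype V
  have hsum (f : V → ℝ) : ∑ w, Γ.outflow f w = 0 := by
    simpa using Γ.sum_mul_outflow (fun _ => 1) f
  have hconst (f : V → ℝ) (hf : ∀ w, Γ.outflow f w = 0) (a b : V) : f a = f b := by
    have h0 : ∑ e, (f (Γ.src e) - f (Γ.tgt e)) * (f (Γ.src e) - f (Γ.tgt e)) / Γ.length e = 0 := by
      rw [← Γ.sum_mul_outflow f f]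
      simp [hf]
    rw [Finset.sum_eq_zero_iff_of_nonneg
      fun e _ => div_nonneg (mul_self_nonneg _) (Γ.length_pos e).le] at h0
    induction h.2 a b with
    | rel a b hab =>
      obtain ⟨e, rfl, rfl⟩ := hab
      have := h0 e (Finset.mem_univ _)
      have hl := (Γ.length_pos e).ne'
      have h1 : f (Γ.src e) - f (Γ.tgt e) = 0 := by simpa [hl] using this
      linarith
    | refl a => rfl
    | symm a b _ ih => exact ih.symm
    | trans a b c _ _ ih₁ ih₂ => exact ih₁.trans ih₂
  let T : (V → ℝ) →ₗ[ℝ] (V → ℝ) :=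
    { toFun := fun f w => Γ.outflow f w + if w = z then f z else 0
      map_add' := by
        intro f g
        funext w
        have : Γ.outflow (f + g) w = Γ.outflow f w + Γ.outflow g w := by
          simp only [outflow, Pi.add_apply, add_sub_add_comm, add_div, Finset.sum_add_distrib]
          ring
        simp only [Pi.add_apply, this]
        split_ifs <;> ring
      map_smul' := by
        intro c f
        funext w
        have : Γ.outflow (c • f) w = c * Γ.outflow f w := by
          simp only [outflow, Pi.smul_apply, smul_eq_mul, ← mul_sub, mul_div_assoc, mul_add,
            Finset.mul_sum]
        simp only [Pi.smul_apply, smul_eq_mul, this, RingHom.id_apply]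
        split_ifs <;> ring }
  have hTapp (f : V → ℝ) (w : V) : T f w = Γ.outflow f w + if w = z then f z else 0 := rfl
  have hTsum (f : V → ℝ) : ∑ w, T f w = f z := by
    simp [hTapp, Finset.sum_add_distrib, hsum]
  have hinj : Function.Injective T := by
    rw [← LinearMap.ker_eq_bot, LinearMap.ker_eq_bot']
    intro f hf
    have hz : f z = 0 := by rw [← hTsum f, hf]; simp
    have h1 (w : V) : Γ.outflow f w = 0 := by
      have := hTapp f w
      rw [hf, hz] at this
      simpa using this.symm
    funext w
    rw [hconst f h1 w z, hz]; rfl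
  obtain ⟨f, hf⟩ := LinearMap.injective_iff_surjective.mp hinj
    fun w => (if w = y then 1 else 0) - (if w = z then 1 else 0)
  have hz : f z = 0 := by rw [← hTsum f, hf]; simp
  refine ⟨f, ⟨hz, fun w => ?_⟩, fun g hg => hinj ?_⟩
  · have := hTapp f w
    rw [hf, hz] at this
    simpa using this.symm
  · rw [hf]
    funext w
    rw [hTapp, hg.1, hg.2]
    simp

open Classical in
/-- The voltage function `j_z(x, y)`: the voltage difference between `x` and `z` when unit current
enters at `y` and exits at `z`.  (It is `0` by convention if no potential exists, which does not
happen on a connected graph.) -/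
noncomputable def voltage (Γ : EdgeMetricGraph V E) (z x y : V) : ℝ :=
  if h : ∃ f, Γ.IsVoltage z y f then h.choose x else 0

/-- The effective resistance `r(x, y) = j_y(x, x)`. -/
noncomputable def resistance (Γ : EdgeMetricGraph V E) (x y : V) : ℝ := Γ.voltage y x x

end Voltage

section Invariants

variable [Fintype E] [DecidableEq E]

/-- `R_e`: the resistance in `Γ - e` between the end points of `e` (used if `e` is not a bridge). -/
noncomputable def R (Γ : EdgeMetricGraph V E) (e : E) : ℝ :=
  (Γ.delete e).resistance (Γ.src e) (Γ.tgt e)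

/-- `R_{a,p} = ĵ_{src e}(p, tgt e)`, with `ĵ` the voltage function of `Γ - e`
(used if `e` is not a bridge). -/
noncomputable def Ra (Γ : EdgeMetricGraph V E) (e : E) (p : V) : ℝ :=
  (Γ.delete e).voltage (Γ.src e) p (Γ.tgt e)

/-- `R_{b,p} = ĵ_{tgt e}(p, src e)`, with `ĵ` the voltage function of `Γ - e`
(used if `e` is not a bridge). -/
noncomputable def Rb (Γ : EdgeMetricGraph V E) (e : E) (p : V) : ℝ :=
  (Γ.delete e).voltage (Γ.tgt e) p (Γ.src e)

open Classical in
/-- The value of an expression `F R_e R_{a,p} R_{b,p}`.  If `e` is a bridge, one puts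
`(R_{a,p}, R_{b,p}) = (0, R_e)` when `p` lies on the side of `src e` in `Γ - e`, and
`(R_{a,p}, R_{b,p}) = (R_e, 0)` otherwise, and then lets `R_e → ∞`. -/
noncomputable def evalEdge (Γ : EdgeMetricGraph V E) (e : E) (p : V) (F : ℝ → ℝ → ℝ → ℝ) : ℝ :=
  if Γ.IsBridge e then
    if (Γ.delete e).Reachable (Γ.src e) p then limUnder atTop fun r : ℝ => F r 0 r
    else limUnder atTop fun r : ℝ => F r r 0
  else F (Γ.R e) (Γ.Ra e p) (Γ.Rb e p)

open Classical in
/-- `R_e / (L_e + R_e)`, read as its limit for `R_e → ∞` if `e` is a bridge. -/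
noncomputable def weight (Γ : EdgeMetricGraph V E) (e : E) : ℝ :=
  if Γ.IsBridge e then limUnder atTop fun r : ℝ => r / (Γ.length e + r)
  else Γ.R e / (Γ.length e + Γ.R e)

/-- The term `L_e² R_e / (L_e + R_e)²`. -/
noncomputable def termA (Γ : EdgeMetricGraph V E) (e : E) (p : V) : ℝ :=
  Γ.evalEdge e p fun R _ _ => Γ.length e ^ 2 * R / (Γ.length e + R) ^ 2

/-- The term `L_e R_e² / (L_e + R_e)²`. -/
noncomputable def termB (Γ : EdgeMetricGraph V E) (e : E) (p : V) : ℝ :=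
  Γ.evalEdge e p fun R _ _ => Γ.length e * R ^ 2 / (Γ.length e + R) ^ 2

/-- The term `L_e (R_{a,p} - R_{b,p})² / (L_e + R_e)²`. -/
noncomputable def termC (Γ : EdgeMetricGraph V E) (e : E) (p : V) : ℝ :=
  Γ.evalEdge e p fun R a b => Γ.length e * (a - b) ^ 2 / (Γ.length e + R) ^ 2

/-- The invariant `x(Γ)`, computed with the base vertex `p`. -/
noncomputable def xInv (Γ : EdgeMetricGraph V E) (p : V) : ℝ :=
  ∑ e, Γ.termA e p + 3 / 4 * ∑ e, Γ.termB e p - 3 / 4 * ∑ e, Γ.termC e p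

/-- The invariant `y(Γ)`, computed with the base vertex `p`. -/
noncomputable def yInv (Γ : EdgeMetricGraph V E) (p : V) : ℝ :=
  1 / 4 * ∑ e, Γ.termB e p + 3 / 4 * ∑ e, Γ.termC e p

/-- The limit in `weight` exists and is `1`. -/
theorem tendsto_weight (L : ℝ) : Tendsto (fun r : ℝ => r / (L + r)) atTop (𝓝 1) := by
  have h1 : Tendsto (fun r : ℝ => 1 - L / (L + r)) atTop (𝓝 (1 - 0)) :=
    tendsto_const_nhds.sub
      (tendsto_const_nhds.div_atTop (tendsto_atTop_add_const_left _ L tendsto_id))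
  rw [sub_zero] at h1
  refine h1.congr' ?_
  filter_upwards [eventually_gt_atTop (-L)] with r hr
  have : L + r ≠ 0 := by linarith
  field_simp
  ring

/-- The limit in `termA` exists and is `0`. -/
theorem tendsto_termA (L : ℝ) :
    Tendsto (fun r : ℝ => L ^ 2 * r / (L + r) ^ 2) atTop (𝓝 0) := by
  have h1 : Tendsto (fun r : ℝ => L ^ 2 / (L + r)) atTop (𝓝 0) :=
    tendsto_const_nhds.div_atTop (tendsto_atTop_add_const_left _ L tendsto_id)
  have h2 := h1.mul (tendsto_weight L)
  rw [zero_mul] at h2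
  refine h2.congr fun r => ?_
  rw [div_mul_div_comm, pow_two (L + r)]

/-- The limit in `termB` (and, up to sign, in `termC`) exists and is `L_e`. -/
theorem tendsto_termB (L : ℝ) :
    Tendsto (fun r : ℝ => L * r ^ 2 / (L + r) ^ 2) atTop (𝓝 L) := by
  have h := ((tendsto_weight L).pow 2).const_mul L
  rw [one_pow, mul_one] at h
  refine h.congr fun r => ?_
  rw [div_pow, mul_div_assoc]

theorem weight_of_isBridge {Γ : EdgeMetricGraph V E} {e : E} (h : Γ.IsBridge e) :
    Γ.weight e = 1 := by
  rw [weight, if_pos h, (tendsto_weight _).limUnder_eq]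

theorem termA_of_isBridge {Γ : EdgeMetricGraph V E} {e : E} (h : Γ.IsBridge e) (p : V) :
    Γ.termA e p = 0 := by
  rw [termA, evalEdge, if_pos h, (tendsto_termA _).limUnder_eq, ite_self]

theorem termB_of_isBridge {Γ : EdgeMetricGraph V E} {e : E} (h : Γ.IsBridge e) (p : V) :
    Γ.termB e p = Γ.length e := by
  rw [termB, evalEdge, if_pos h, (tendsto_termB _).limUnder_eq, ite_self]

theorem termC_of_isBridge {Γ : EdgeMetricGraph V E} {e : E} (h : Γ.IsBridge e) (p : V) :
    Γ.termC e p = Γ.length e := by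
  rw [termC, evalEdge, if_pos h]
  simp only [zero_sub, sub_zero, neg_sq, (tendsto_termB _).limUnder_eq, ite_self]

end Invariants

end EdgeMetricGraph

namespace EdgeMetricGraph

universe u v

variable {V : Type u} {E : Type v} [Fintype E]

/-! Everything is expressed through the effective resistance r of Γ itself. With r_e = r(src e, tgt
e), the parallel law turns the weight R_e/(L_e + R_e) into r_e/L_e, bridges included, and gives x +
y = Σ r_e and 4y = B + 3P. Here B = Σ r_e²/L_e, and P = Σ (r(src e, p) − r(tgt e, p))²/L_e is
independent of p (`pointEnergy_eq`). It suffices to treat y and x + y.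

Contracting e short-circuits its ends: with φ_e = r(src e, ·) − r(tgt e, ·), the new resistance is
r(x, y) − (φ_e(x) − φ_e(y))²/(4 r_e) (`IsResistance.contract`). An edge f then enters through the
half-drop d_ef = d_fe of φ_e along f and the means m_ef of φ_e over f and m_fe of φ_f over e.
Testing Kirchhoff's law against φ_e and φ_e³ gives Σ_f d_ef²/L_f = r_e and Σ_f (d_ef⁴ + 3 d_ef²
m_ef²)/L_f = r_e³; the ratio 1 : 3 is that of B and P in y.

Foster's theorem Σ r_e/L_e = v − 1 supplies the main term, and the corrections remove exactly one
more copy of the invariant. The mixed double sum of d_ef m_fe m_ef/(L_e L_f) is evaluated in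
`sum_halfDrop_mul_edgeMean`, from the constancy of P. -/

/-- The bilinear energy form (Dirichlet form) of two functions on the vertices. -/
noncomputable def energy (Γ : EdgeMetricGraph V E) (g f : V → ℝ) : ℝ :=
  ∑ e, (g (Γ.src e) - g (Γ.tgt e)) * (f (Γ.src e) - f (Γ.tgt e)) / Γ.length e

/-! ### Energy form, weak Kirchhoff law and effective resistance -/

theorem energy_comm (Γ : EdgeMetricGraph V E) (g f : V → ℝ) : Γ.energy g f = Γ.energy f g :=
  Finset.sum_congr rfl fun e _ => by rw [mul_comm]

theorem energy_smul_right (Γ : EdgeMetricGraph V E) (g f : V → ℝ) (c : ℝ) :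
    Γ.energy g (fun x => c * f x) = c * Γ.energy g f := by
  rw [energy, energy, Finset.mul_sum]
  exact Finset.sum_congr rfl fun e _ => by ring

/-- The weak form of Kirchhoff's node law. -/
theorem isVoltage_iff_energy [Finite V] (Γ : EdgeMetricGraph V E) (z y : V) (f : V → ℝ) :
    Γ.IsVoltage z y f ↔ f z = 0 ∧ ∀ g, Γ.energy g f = g y - g z := by
  classical
  cases nonempty_fintype V
  refine and_congr_right fun _ => ⟨fun h g => ?_, fun h w => ?_⟩
  · rw [energy, ← sum_mul_outflow]
    simp only [h, mul_sub, Finset.sum_sub_distrib, mul_ite, mul_one, mul_zero, Finset.sum_ite_eq',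
      Finset.mem_univ, if_true]
  · have := h fun x => if w = x then 1 else 0
    have h2 := (Γ.sum_mul_outflow (fun x => if w = x then 1 else 0) f).trans this
    simpa using h2

theorem voltage_eq [Finite V] {Γ : EdgeMetricGraph V E} (hΓ : Γ.Connected) {z y : V} {f : V → ℝ}
    (hz : f z = 0) (hf : ∀ g, Γ.energy g f = g y - g z) (x : V) : Γ.voltage z x y = f x := by
  have h := (Γ.isVoltage_iff_energy z y f).2 ⟨hz, hf⟩
  have hex : ∃ f, Γ.IsVoltage z y f := ⟨f, h⟩
  rw [voltage, dif_pos hex]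
  exact congrFun ((existsUnique_isVoltage hΓ z y).unique hex.choose_spec h) x

/-- `r` is the effective resistance function of `Γ`, characterized by its Laplacian. -/
structure IsResistance (Γ : EdgeMetricGraph V E) (r : V → V → ℝ) : Prop where
  symm : ∀ x y, r x y = r y x
  self : ∀ x, r x x = 0
  energy_sub : ∀ g p s, Γ.energy g (fun x => r p x - r s x) = 2 * (g s - g p)

/-- Ground the circuit at `o` and let `G y` be the potential of a unit current from `y` to `o`;
symmetry of the energy makes `G` symmetric. In `r p x - r s x` the diagonal terms `G x x` cancel, so
the Laplacian is explicit. -/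
theorem Connected.exists_isResistance [Finite V] {Γ : EdgeMetricGraph V E} (hΓ : Γ.Connected) :
    ∃ r, Γ.IsResistance r := by
  obtain ⟨o⟩ := hΓ.1
  choose G hG using fun y => (existsUnique_isVoltage hΓ o y).exists
  have hE (g : V → ℝ) (y : V) : Γ.energy g (G y) = g y - g o :=
    ((Γ.isVoltage_iff_energy o y _).1 (hG y)).2 g
  have hs (x y : V) : G x y = G y x := by
    have h := Γ.energy_comm (G x) (G y)
    rwa [hE, hE, (hG x).1, (hG y).1, sub_zero, sub_zero] at h
  refine ⟨fun x y => G x x + G y y - 2 * G x y, fun x y => ?_, fun x => by ring, fun g p s => ?_⟩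
  · rw [hs x y]; ring
  · have hp := hE g p
    have hs := hE g s
    have : Γ.energy g (fun x => G p p + G x x - 2 * G p x - (G s s + G x x - 2 * G s x))
        = 2 * (Γ.energy g (G s) - Γ.energy g (G p)) := by
      simp only [energy, ← Finset.sum_sub_distrib, Finset.mul_sum]
      exact Finset.sum_congr rfl fun e _ => by ring
    rw [this, hp, hs]; ring

theorem energy_delete [DecidableEq E] (Γ : EdgeMetricGraph V E) (e : E)
    (g f : V → ℝ) :
    Γ.energy g f = (g (Γ.src e) - g (Γ.tgt e)) * (f (Γ.src e) - f (Γ.tgt e)) / Γ.length e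
      + (Γ.delete e).energy g f :=
  Fintype.sum_eq_add_sum_subtype_ne _ e

theorem IsResistance.voltage_eq [Finite V] {Γ : EdgeMetricGraph V E} {r : V → V → ℝ}
    (hr : Γ.IsResistance r) (hΓ : Γ.Connected) (z x y : V) :
    Γ.voltage z x y = (r z x + r z y - r x y) / 2 := by
  refine EdgeMetricGraph.voltage_eq hΓ (f := fun x => (r z x + r z y - r x y) / 2) ?_ ?_ x
  · simp [hr.self]
  · intro g
    have h := hr.energy_sub g z y
    have : Γ.energy g (fun x => (r z x + r z y - r x y) / 2)
        = 1 / 2 * Γ.energy g (fun x => r z x - r y x) := by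
      rw [← energy_smul_right]
      simp only [energy, hr.symm y]
      exact Finset.sum_congr rfl fun e _ => by ring
    rw [this, h]; ring

theorem not_reachable_of_isBridge {V : Type u} {E : Type v}
    {Γ : EdgeMetricGraph V E} (hΓ : Γ.Connected) {e : E} (he : Γ.IsBridge e) :
    ¬ (Γ.delete e).Reachable (Γ.src e) (Γ.tgt e) := by
  refine fun h => he ⟨hΓ.1, fun a b => ?_⟩
  induction hΓ.2 a b with
  | rel a b hab =>
    obtain ⟨f, rfl, rfl⟩ := hab
    by_cases hf : f = e
    · exact hf ▸ h
    · exact Relation.EqvGen.rel _ _ ⟨⟨f, hf⟩, rfl, rfl⟩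
  | refl a => exact Relation.EqvGen.refl _
  | symm a b _ ih => exact Relation.EqvGen.symm _ _ ih
  | trans a b c _ _ ih₁ ih₂ => exact Relation.EqvGen.trans _ _ _ ih₁ ih₂

/-! ### Weights and summands in terms of the effective resistance -/

section Terms

variable [Finite V] [DecidableEq E] {Γ : EdgeMetricGraph V E} {r : V → V → ℝ}

open Classical in
/-- The voltage function of a bridge is locally constant off the bridge. -/
theorem voltage_of_isBridge (hΓ : Γ.Connected) {e : E} (he : Γ.IsBridge e) (x : V) :
    Γ.voltage (Γ.src e) x (Γ.tgt e)
      = if (Γ.delete e).Reachable (Γ.src e) x then 0 else Γ.length e := by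
  refine voltage_eq hΓ
    (f := fun x => if (Γ.delete e).Reachable (Γ.src e) x then 0 else Γ.length e) ?_ ?_ x
  · exact if_pos (Relation.EqvGen.refl _)
  · intro g
    have h0 : (Γ.delete e).energy g
        (fun x => if (Γ.delete e).Reachable (Γ.src e) x then 0 else Γ.length e) = 0 := by
      refine Finset.sum_eq_zero fun f _ => ?_
      have hf : (Γ.delete e).Reachable ((Γ.delete e).src f) ((Γ.delete e).tgt f) :=
        Relation.EqvGen.rel _ _ ⟨f, rfl, rfl⟩
      have : (Γ.delete e).Reachable (Γ.src e) ((Γ.delete e).src f)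
          ↔ (Γ.delete e).Reachable (Γ.src e) ((Γ.delete e).tgt f) :=
        ⟨fun h => Relation.EqvGen.trans _ _ _ h hf,
          fun h => Relation.EqvGen.trans _ _ _ h (Relation.EqvGen.symm _ _ hf)⟩
      simp [this]
    have hl := (Γ.length_pos e).ne'
    rw [energy_delete Γ e, h0, if_pos (show (Γ.delete e).Reachable _ _ from Relation.EqvGen.refl _),
      if_neg (not_reachable_of_isBridge hΓ he)]
    field_simp
    ring

/-- Deleting a non-bridge rescales the voltage function of its end points. -/
theorem voltage_of_not_isBridge (hΓ : Γ.Connected) {e : E} (he : ¬ Γ.IsBridge e) :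
    0 ≤ Γ.R e ∧ (∀ x, Γ.Rb e x = Γ.R e - Γ.Ra e x) ∧ Γ.Ra e (Γ.tgt e) = Γ.R e ∧
      ∀ x, Γ.voltage (Γ.src e) x (Γ.tgt e)
        = Γ.length e / (Γ.length e + Γ.R e) * Γ.Ra e x := by
  have hd : (Γ.delete e).Connected := not_not.1 he
  obtain ⟨h, hh⟩ := (existsUnique_isVoltage hd (Γ.src e) (Γ.tgt e)).exists
  rw [isVoltage_iff_energy] at hh
  obtain ⟨hz, hh⟩ := hh
  have hRa (x : V) : Γ.Ra e x = h x := voltage_eq hd hz hh x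
  have hvb (x : V) : (Γ.delete e).voltage (Γ.tgt e) x (Γ.src e) = h (Γ.tgt e) - h x := by
    refine voltage_eq hd (f := fun x => h (Γ.tgt e) - h x) (sub_self _) (fun g => ?_) x
    have : (Γ.delete e).energy g (fun x => h (Γ.tgt e) - h x) = -1 * (Γ.delete e).energy g h := by
      rw [← energy_smul_right]
      exact Finset.sum_congr rfl fun e _ => by ring
    rw [this, hh]; ring
  have hR : Γ.R e = h (Γ.tgt e) := by
    rw [R, resistance, hvb, hz, sub_zero]
  have hR0 : 0 ≤ Γ.R e := by
    have h1 := hh h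
    rw [hz, sub_zero] at h1
    rw [hR, ← h1]
    exact Finset.sum_nonneg fun f _ => div_nonneg (mul_self_nonneg _) ((Γ.delete e).length_pos f).le
  refine ⟨hR0, fun x => ?_, by rw [hRa, hR], fun x => ?_⟩
  · rw [hRa, hR]; exact hvb x
  · have hl := Γ.length_pos e
    have hlR : Γ.length e + Γ.R e ≠ 0 := by positivity
    refine voltage_eq hΓ (f := fun x => Γ.length e / (Γ.length e + Γ.R e) * Γ.Ra e x) ?_ ?_ x
    · simp [hRa, hz]
    · intro g
      have hfun : Γ.Ra e = h := funext hRa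
      rw [energy_smul_right, hfun, energy_delete Γ e, hh, hz, ← hR]
      field_simp
      ring

variable (hr : Γ.IsResistance r) (hΓ : Γ.Connected)
include hr hΓ

/-- A bridge carries all the current between its ends, so the potential is 0 on one side and `length
e` on the other; the side of `p` affects only a sign, which the square removes. -/
theorem IsResistance.of_isBridge {e : E} (he : Γ.IsBridge e) :
    r (Γ.src e) (Γ.tgt e) = Γ.length e ∧
      ∀ p, (r (Γ.src e) p - r (Γ.tgt e) p) ^ 2 = Γ.length e ^ 2 := by
  have h1 := voltage_of_isBridge hΓ he
  have h2 := h1 (Γ.tgt e)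
  rw [if_neg (not_reachable_of_isBridge hΓ he), hr.voltage_eq hΓ, hr.self] at h2
  have h3 : r (Γ.src e) (Γ.tgt e) = Γ.length e := by linarith
  refine ⟨h3, fun p => ?_⟩
  have h4 := h1 p
  rw [hr.voltage_eq hΓ, hr.symm p, h3] at h4
  split_ifs at h4
  · rw [show r (Γ.src e) p - r (Γ.tgt e) p = -Γ.length e by linarith]; ring
  · rw [show r (Γ.src e) p - r (Γ.tgt e) p = Γ.length e by linarith]

/-- The edge and the rest of the circuit are resistors L_e and R_e in parallel. The last formula
follows from j = (r_e + r(src e, p) − r(tgt e, p))/2 and R_a + R_b = R_e. -/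
theorem IsResistance.of_not_isBridge {e : E} (he : ¬ Γ.IsBridge e) :
    0 < Γ.length e + Γ.R e ∧
    r (Γ.src e) (Γ.tgt e) = Γ.length e * Γ.R e / (Γ.length e + Γ.R e) ∧
      ∀ p, r (Γ.src e) p - r (Γ.tgt e) p
        = Γ.length e * (Γ.Ra e p - Γ.Rb e p) / (Γ.length e + Γ.R e) := by
  obtain ⟨h0, hb, ht, hv⟩ := voltage_of_not_isBridge hΓ he
  have hpos : 0 < Γ.length e + Γ.R e := by have := Γ.length_pos e; positivity
  have h2 := hv (Γ.tgt e)
  rw [hr.voltage_eq hΓ, hr.self, ht] at h2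
  have h3 : r (Γ.src e) (Γ.tgt e) = Γ.length e * Γ.R e / (Γ.length e + Γ.R e) := by
    rw [mul_div_right_comm]; linarith
  refine ⟨hpos, h3, fun p => ?_⟩
  have h4 := hv p
  rw [hr.voltage_eq hΓ, hr.symm p] at h4
  have h5 : r (Γ.src e) p - r (Γ.tgt e) p
      = 2 * (Γ.length e / (Γ.length e + Γ.R e) * Γ.Ra e p) - r (Γ.src e) (Γ.tgt e) := by linarith
  rw [h5, h3, hb]
  ring

theorem IsResistance.weight_eq (e : E) : Γ.weight e = r (Γ.src e) (Γ.tgt e) / Γ.length e := by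
  have hl := (Γ.length_pos e).ne'
  by_cases he : Γ.IsBridge e
  · rw [weight_of_isBridge he, (hr.of_isBridge hΓ he).1, div_self hl]
  · obtain ⟨h0, h1, -⟩ := hr.of_not_isBridge hΓ he
    rw [weight, if_neg he, h1]
    field_simp

theorem IsResistance.termA_eq (e : E) (p : V) :
    Γ.termA e p = r (Γ.src e) (Γ.tgt e) - r (Γ.src e) (Γ.tgt e) ^ 2 / Γ.length e := by
  have hl := (Γ.length_pos e).ne'
  by_cases he : Γ.IsBridge e
  · rw [termA_of_isBridge he, (hr.of_isBridge hΓ he).1]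
    field_simp
    ring
  · obtain ⟨h0, h1, -⟩ := hr.of_not_isBridge hΓ he
    rw [termA, evalEdge, if_neg he, h1]
    field_simp
    ring

theorem IsResistance.termB_eq (e : E) (p : V) :
    Γ.termB e p = r (Γ.src e) (Γ.tgt e) ^ 2 / Γ.length e := by
  have hl := (Γ.length_pos e).ne'
  by_cases he : Γ.IsBridge e
  · rw [termB_of_isBridge he, (hr.of_isBridge hΓ he).1]
    field_simp
  · obtain ⟨h0, h1, -⟩ := hr.of_not_isBridge hΓ he
    rw [termB, evalEdge, if_neg he, h1]
    field_simp

theorem IsResistance.termC_eq (e : E) (p : V) :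
    Γ.termC e p = (r (Γ.src e) p - r (Γ.tgt e) p) ^ 2 / Γ.length e := by
  have hl := (Γ.length_pos e).ne'
  by_cases he : Γ.IsBridge e
  · rw [termC_of_isBridge he, (hr.of_isBridge hΓ he).2]
    field_simp
  · obtain ⟨h0, -, h1⟩ := hr.of_not_isBridge hΓ he
    rw [termC, evalEdge, if_neg he, h1]
    field_simp

end Terms

/-! ### Edge sums and edge potentials -/

/-- The total edge resistance `∑ r_e`. -/
noncomputable def edgeSum (Γ : EdgeMetricGraph V E) (r : V → V → ℝ) : ℝ :=
  ∑ e, r (Γ.src e) (Γ.tgt e)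

/-- The sum `∑ r_e² / L_e`. -/
noncomputable def edgeSqSum (Γ : EdgeMetricGraph V E) (r : V → V → ℝ) : ℝ :=
  ∑ e, r (Γ.src e) (Γ.tgt e) ^ 2 / Γ.length e

/-- The energy of the function `r(·, p)`. -/
noncomputable def pointEnergy (Γ : EdgeMetricGraph V E) (r : V → V → ℝ) (p : V) : ℝ :=
  ∑ e, (r (Γ.src e) p - r (Γ.tgt e) p) ^ 2 / Γ.length e

/-- The function `r(src e, ·) - r(tgt e, ·)`. -/
def edgePotential (Γ : EdgeMetricGraph V E) (r : V → V → ℝ) (e : E)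
    (x : V) : ℝ :=
  r (Γ.src e) x - r (Γ.tgt e) x

/-- Half the drop of the potential of `e` along `f`. -/
noncomputable def halfDrop (Γ : EdgeMetricGraph V E) (r : V → V → ℝ)
    (e f : E) : ℝ :=
  (Γ.edgePotential r e (Γ.src f) - Γ.edgePotential r e (Γ.tgt f)) / 2

/-- The mean of the potential of `e` over the end points of `f`. -/
noncomputable def edgeMean (Γ : EdgeMetricGraph V E) (r : V → V → ℝ)
    (e f : E) : ℝ :=
  (Γ.edgePotential r e (Γ.src f) + Γ.edgePotential r e (Γ.tgt f)) / 2

theorem IsResistance.yInv_eq [Finite V] [DecidableEq E] {Γ : EdgeMetricGraph V E}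
    {r : V → V → ℝ} (hr : Γ.IsResistance r) (hΓ : Γ.Connected) (p : V) :
    Γ.yInv p = 1 / 4 * (Γ.edgeSqSum r + 3 * Γ.pointEnergy r p) := by
  simp only [yInv, hr.termB_eq hΓ, hr.termC_eq hΓ, edgeSqSum, pointEnergy]
  ring

theorem IsResistance.xInv_eq [Finite V] [DecidableEq E] {Γ : EdgeMetricGraph V E}
    {r : V → V → ℝ} (hr : Γ.IsResistance r) (hΓ : Γ.Connected) (p : V) :
    Γ.xInv p = Γ.edgeSum r - Γ.yInv p := by
  rw [hr.yInv_eq hΓ]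
  simp only [xInv, hr.termA_eq hΓ, hr.termB_eq hΓ, hr.termC_eq hΓ, Finset.sum_sub_distrib,
    edgeSum, edgeSqSum, pointEnergy]
  ring

/-! ### Foster's theorem and the identities for half-drops and means -/

namespace IsResistance

variable {Γ : EdgeMetricGraph V E} {r : V → V → ℝ}

/-- As a difference of squares, P(p) − P(s) is the energy of r_p + r_s against r_p − r_s, and the
two contributions cancel by symmetry of r. -/
theorem pointEnergy_eq (hr : Γ.IsResistance r) (p s : V) :
    Γ.pointEnergy r p = Γ.pointEnergy r s := by
  have h1 := hr.energy_sub (r p) p s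
  have h2 := hr.energy_sub (r s) p s
  have h3 : Γ.pointEnergy r p - Γ.pointEnergy r s
      = Γ.energy (r p) (fun x => r p x - r s x) + Γ.energy (r s) (fun x => r p x - r s x) := by
    simp only [pointEnergy, energy, ← Finset.sum_sub_distrib, ← Finset.sum_add_distrib, hr.symm _ p,
      hr.symm _ s]
    exact Finset.sum_congr rfl fun e _ => by ring
  rw [h1, h2, hr.self, hr.self, hr.symm s p] at h3
  linarith

/-- Foster's theorem. -/
theorem foster [Finite V] [Nonempty V] (hr : Γ.IsResistance r) :
    ∑ e, r (Γ.src e) (Γ.tgt e) / Γ.length e = (Nat.card V : ℝ) - 1 := by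
  classical
  cases nonempty_fintype V
  obtain ⟨o⟩ := ‹Nonempty V›
  -- Testing against the indicator of each `w` and summing is a trace; the `r o` terms cancel edge
  -- by edge.
  have h1 : ∑ w, Γ.energy (fun x => if x = w then 1 else 0) (fun x => r w x - r o x)
      = 2 * (1 - (Nat.card V : ℝ)) := by
    simp_rw [hr.energy_sub]
    simp [← Finset.mul_sum, Nat.card_eq_fintype_card]
  have h2 : ∑ w, Γ.energy (fun x => if x = w then 1 else 0) (fun x => r w x - r o x)
      = -2 * ∑ e, r (Γ.src e) (Γ.tgt e) / Γ.length e := by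
    simp only [energy]
    rw [Finset.sum_comm, Finset.mul_sum]
    refine Finset.sum_congr rfl fun e _ => ?_
    simp only [sub_mul, sub_div, Finset.sum_sub_distrib, ite_mul, one_mul, zero_mul, ite_div,
      zero_div, Finset.sum_ite_eq, Finset.mem_univ, if_true, hr.self, hr.symm (Γ.tgt e) (Γ.src e)]
    ring
  linarith

variable (hr : Γ.IsResistance r)
include hr

theorem edgePotential_src (e : E) :
    Γ.edgePotential r e (Γ.src e) = -r (Γ.src e) (Γ.tgt e) := by
  rw [edgePotential, hr.self, hr.symm (Γ.tgt e), zero_sub]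

theorem edgePotential_tgt (e : E) :
    Γ.edgePotential r e (Γ.tgt e) = r (Γ.src e) (Γ.tgt e) := by
  rw [edgePotential, hr.self, sub_zero]

theorem halfDrop_comm (e f : E) : Γ.halfDrop r e f = Γ.halfDrop r f e := by
  simp only [halfDrop, edgePotential, hr.symm (Γ.src f), hr.symm (Γ.tgt f)]
  ring

theorem energy_edgePotential (e : E) (g : V → ℝ) :
    Γ.energy g (Γ.edgePotential r e) = 2 * (g (Γ.tgt e) - g (Γ.src e)) :=
  hr.energy_sub g _ _

theorem sum_halfDrop_sq (e : E) :
    ∑ f, Γ.halfDrop r e f ^ 2 / Γ.length f = r (Γ.src e) (Γ.tgt e) := by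
  have h := hr.energy_edgePotential e (Γ.edgePotential r e)
  rw [hr.edgePotential_src, hr.edgePotential_tgt] at h
  have h2 : ∑ f, Γ.halfDrop r e f ^ 2 / Γ.length f
      = 1 / 4 * Γ.energy (Γ.edgePotential r e) (Γ.edgePotential r e) := by
    rw [energy, Finset.mul_sum]
    exact Finset.sum_congr rfl fun f _ => by rw [halfDrop]; ring
  rw [h2, h]; ring

/-- Needed for self-loops, where the formulas dividing by r_e are unavailable. -/
theorem halfDrop_eq_zero {e : E} (he : r (Γ.src e) (Γ.tgt e) = 0) (f : E) :
    Γ.halfDrop r e f = 0 := by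
  have h := hr.sum_halfDrop_sq e
  rw [he, Finset.sum_eq_zero_iff_of_nonneg
    fun f _ => div_nonneg (sq_nonneg _) (Γ.length_pos f).le] at h
  simpa [(Γ.length_pos f).ne'] using h f (Finset.mem_univ _)

/-- Test against φ_e³: for end values a, b = m ± d one has (a³ − b³)(a − b) = 4(d⁴ + 3d²m²). -/
theorem sum_halfDrop_cube (e : E) :
    ∑ f, (Γ.halfDrop r e f ^ 4 + 3 * Γ.halfDrop r e f ^ 2 * Γ.edgeMean r e f ^ 2) / Γ.length f
      = r (Γ.src e) (Γ.tgt e) ^ 3 := by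
  have h := hr.energy_edgePotential e (fun x => Γ.edgePotential r e x ^ 3)
  rw [hr.edgePotential_src, hr.edgePotential_tgt] at h
  have h2 : ∑ f, (Γ.halfDrop r e f ^ 4 + 3 * Γ.halfDrop r e f ^ 2 * Γ.edgeMean r e f ^ 2)
        / Γ.length f
      = 1 / 4 * Γ.energy (fun x => Γ.edgePotential r e x ^ 3) (Γ.edgePotential r e) := by
    rw [energy, Finset.mul_sum]
    exact Finset.sum_congr rfl fun f _ => by rw [halfDrop, edgeMean]; ring
  rw [h2, h]; ring

/-- The mean square of φ_f over the two ends of e is m² + d²; summed over f, each end alone gives P.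
-/
theorem sum_edgeMean_sq (e : E) (o : V) :
    ∑ f, Γ.edgeMean r f e ^ 2 / Γ.length f
      = Γ.pointEnergy r o - r (Γ.src e) (Γ.tgt e) := by
  have h1 := hr.pointEnergy_eq (Γ.src e) o
  have h2 := hr.pointEnergy_eq (Γ.tgt e) o
  rw [← hr.sum_halfDrop_sq e]
  have h3 : ∑ f, Γ.edgeMean r f e ^ 2 / Γ.length f + ∑ f, Γ.halfDrop r e f ^ 2 / Γ.length f
      = 1 / 2 * (Γ.pointEnergy r (Γ.src e) + Γ.pointEnergy r (Γ.tgt e)) := by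
    simp only [pointEnergy, Finset.mul_sum, ← Finset.sum_add_distrib]
    refine Finset.sum_congr rfl fun f _ => ?_
    rw [hr.halfDrop_comm, halfDrop, edgeMean, edgePotential, edgePotential]
    ring
  linarith

/-- For fixed f, d_fe m_fe is a quarter of the drop of φ_f² along e, and m_ef averages the drop of
r(x, ·) along e over the ends x of f. The sum over e is thus an energy of φ_f² against r(x, ·), and
x can be moved to `o`. -/
theorem sum_halfDrop_mul_edgeMean (o : V) :
    ∑ e, ∑ f, Γ.halfDrop r e f * Γ.edgeMean r f e * Γ.edgeMean r e f / Γ.length f / Γ.length e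
      = (Γ.pointEnergy r o - Γ.edgeSqSum r) / 2 := by
  have hE (f : E) (x : V) : Γ.energy (fun w => Γ.edgePotential r f w ^ 2) (r x)
      = Γ.energy (fun w => Γ.edgePotential r f w ^ 2) (r o)
        + 2 * (Γ.edgePotential r f o ^ 2 - Γ.edgePotential r f x ^ 2) := by
    rw [← hr.energy_sub (fun w => Γ.edgePotential r f w ^ 2) x o]
    simp only [energy, ← Finset.sum_add_distrib]
    exact Finset.sum_congr rfl fun e _ => by ring
  -- Summed over f, φ_f(w)²/L_f is P(w), a constant function of w, so its energy vanishes.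
  have h0 : ∑ f, Γ.energy (fun w => Γ.edgePotential r f w ^ 2) (r o) / Γ.length f = 0 := by
    simp only [energy, Finset.sum_div]
    rw [Finset.sum_comm]
    refine Finset.sum_eq_zero fun e _ => ?_
    have h := sub_eq_zero.2 (hr.pointEnergy_eq (Γ.src e) (Γ.tgt e))
    have : (Γ.pointEnergy r (Γ.src e) - Γ.pointEnergy r (Γ.tgt e))
        * ((r o (Γ.src e) - r o (Γ.tgt e)) / Γ.length e) = 0 := by rw [h, zero_mul]
    rw [← this, pointEnergy, pointEnergy, ← Finset.sum_sub_distrib, Finset.sum_mul]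
    refine Finset.sum_congr rfl fun f _ => ?_
    rw [edgePotential, edgePotential]
    ring
  have h1 (f : E) :
      ∑ e, Γ.halfDrop r e f * Γ.edgeMean r f e * Γ.edgeMean r e f / Γ.length f / Γ.length e
        = 1 / 4 * (Γ.energy (fun w => Γ.edgePotential r f w ^ 2) (r o) / Γ.length f)
          + 1 / 2 * ((r (Γ.src f) o - r (Γ.tgt f) o) ^ 2 / Γ.length f)
          - 1 / 2 * (r (Γ.src f) (Γ.tgt f) ^ 2 / Γ.length f) := by
    have h2 : ∑ e, Γ.halfDrop r e f * Γ.edgeMean r f e * Γ.edgeMean r e f / Γ.length f / Γ.length e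
        = 1 / 8 * (Γ.energy (fun w => Γ.edgePotential r f w ^ 2) (r (Γ.src f))
          + Γ.energy (fun w => Γ.edgePotential r f w ^ 2) (r (Γ.tgt f))) / Γ.length f := by
      simp only [energy, ← Finset.sum_add_distrib, Finset.mul_sum, Finset.sum_div]
      refine Finset.sum_congr rfl fun e _ => ?_
      rw [hr.halfDrop_comm, halfDrop, edgeMean, edgeMean, 
        edgePotential.eq_def Γ r e (Γ.src f), edgePotential.eq_def Γ r e (Γ.tgt f),
        hr.symm (Γ.src f) (Γ.src e), hr.symm (Γ.src f) (Γ.tgt e), hr.symm (Γ.tgt f) (Γ.src e),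
        hr.symm (Γ.tgt f) (Γ.tgt e)]
      ring
    rw [h2, hE f (Γ.src f), hE f (Γ.tgt f), hr.edgePotential_src, hr.edgePotential_tgt,
      edgePotential.eq_def Γ r f o]
    ring
  rw [Finset.sum_comm]
  simp only [h1, Finset.sum_sub_distrib, Finset.sum_add_distrib, ← Finset.mul_sum, h0]
  rw [pointEnergy, edgeSqSum]
  ring

end IsResistance

/-! ### Resistance after contraction -/

/-- The effective resistance of `Γ` after the end points of `e` are short-circuited. -/
noncomputable def shortResistance (Γ : EdgeMetricGraph V E) (r : V → V → ℝ) (e : E) (x y : V) : ℝ :=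
  r x y - (Γ.edgePotential r e x - Γ.edgePotential r e y) ^ 2 / (4 * r (Γ.src e) (Γ.tgt e))

theorem shortResistance_edge {V : Type u} {E : Type v} (Γ : EdgeMetricGraph V E)
    (r : V → V → ℝ) (e f : E) :
    Γ.shortResistance r e (Γ.src f) (Γ.tgt f)
      = r (Γ.src f) (Γ.tgt f) - Γ.halfDrop r e f ^ 2 / r (Γ.src e) (Γ.tgt e) := by
  rw [shortResistance, halfDrop]
  ring

namespace IsResistance

variable {Γ : EdgeMetricGraph V E} {r : V → V → ℝ} (hr : Γ.IsResistance r)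
include hr

theorem shortResistance_symm (e : E) (x y : V) :
    Γ.shortResistance r e x y = Γ.shortResistance r e y x := by
  rw [shortResistance, shortResistance, hr.symm x y]
  ring

/-- Since φ_e = ∓r_e at the ends, the two corrections differ by ((φ_e(y) + r_e)² − (φ_e(y) −
r_e)²)/(4 r_e) = φ_e(y). -/
theorem shortResistance_src {e : E} (he : r (Γ.src e) (Γ.tgt e) ≠ 0) (y : V) :
    Γ.shortResistance r e (Γ.src e) y = Γ.shortResistance r e (Γ.tgt e) y := by
  rw [shortResistance, shortResistance, hr.edgePotential_src, hr.edgePotential_tgt, edgePotential]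
  field_simp
  ring

theorem shortResistance_congr {e : E} (he : r (Γ.src e) (Γ.tgt e) ≠ 0) {x x' y y' : V}
    (hx : (Quot.mk _ x : Γ.ContractVertex e) = Quot.mk _ x')
    (hy : (Quot.mk _ y : Γ.ContractVertex e) = Quot.mk _ y') :
    Γ.shortResistance r e x y = Γ.shortResistance r e x' y' := by
  have key {x x' : V} (hx : (Quot.mk _ x : Γ.ContractVertex e) = Quot.mk _ x') (y : V) :
      Γ.shortResistance r e x y = Γ.shortResistance r e x' y := by
    have hx' := Quot.eqvGen_exact hx
    induction hx' with
    | rel a b hab => rw [hab.1, hab.2, hr.shortResistance_src he]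
    | refl a => rfl
    | symm a b h ih => exact (ih (Quot.eqvGen_sound h)).symm
    | trans a b c h₁ h₂ ih₁ ih₂ =>
      exact (ih₁ (Quot.eqvGen_sound h₁)).trans (ih₂ (Quot.eqvGen_sound h₂))
  rw [key hx, hr.shortResistance_symm, key hy, hr.shortResistance_symm]

theorem shortResistance_sub (e f : E) (he : r (Γ.src e) (Γ.tgt e) ≠ 0) :
    Γ.shortResistance r e (Γ.src f) (Γ.src e) - Γ.shortResistance r e (Γ.tgt f) (Γ.src e)
      = Γ.edgeMean r f e - Γ.halfDrop r e f * Γ.edgeMean r e f / r (Γ.src e) (Γ.tgt e) := by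
  have h1 := hr.halfDrop_comm e f
  have h2 : r (Γ.src f) (Γ.src e) - r (Γ.tgt f) (Γ.src e)
      = Γ.edgeMean r f e + Γ.halfDrop r e f := by
    rw [h1, edgeMean, halfDrop, edgePotential, edgePotential]; ring
  have h3 : Γ.shortResistance r e (Γ.src f) (Γ.src e) - Γ.shortResistance r e (Γ.tgt f) (Γ.src e)
      = Γ.edgeMean r f e + Γ.halfDrop r e f
        - Γ.halfDrop r e f * (Γ.edgeMean r e f + r (Γ.src e) (Γ.tgt e))
          / r (Γ.src e) (Γ.tgt e) := by
    rw [← h2, shortResistance, shortResistance, hr.edgePotential_src, halfDrop, edgeMean]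
    ring
  rw [h3]
  field_simp
  ring

variable [DecidableEq E]

/-- The effective resistance of a contraction. -/
theorem contract {e : E} (he : r (Γ.src e) (Γ.tgt e) ≠ 0) :
    ∃ r', (Γ.contract e).IsResistance r' ∧
      ∀ x y, r' (Quot.mk _ x) (Quot.mk _ y) = Γ.shortResistance r e x y := by
  have hmk (x y : V) : Γ.shortResistance r e
      (Quot.mk _ x : Γ.ContractVertex e).out (Quot.mk _ y : Γ.ContractVertex e).out
      = Γ.shortResistance r e x y :=
    hr.shortResistance_congr he (Quot.out_eq _) (Quot.out_eq _)
  refine ⟨fun X Y => Γ.shortResistance r e X.out Y.out,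
    ⟨fun X Y => hr.shortResistance_symm _ _ _, fun X => ?_, ?_⟩, hmk⟩
  · simp [shortResistance, hr.self]
  · rintro g ⟨p⟩ ⟨s⟩
    have hg : g (Quot.mk _ (Γ.src e)) = g (Quot.mk _ (Γ.tgt e)) :=
      congrArg g (Quot.sound ⟨rfl, rfl⟩)
    have h1 : (Γ.contract e).energy g (fun X => Γ.shortResistance r e
          (Quot.mk _ p : Γ.ContractVertex e).out X.out - Γ.shortResistance r e
          (Quot.mk _ s : Γ.ContractVertex e).out X.out)
        = Γ.energy (fun x => g (Quot.mk _ x))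
          (fun x => Γ.shortResistance r e p x - Γ.shortResistance r e s x) := by
      rw [energy_delete Γ e, hg, sub_self, zero_mul, zero_div, zero_add]
      simp only [energy, EdgeMetricGraph.contract, EdgeMetricGraph.delete, hmk]
    -- The squares of φ_e(x) cancel, leaving a multiple of φ_e, whose energy against `g` vanishes
    -- because `g` agrees at the two ends of `e`.
    have h2 : Γ.energy (fun x => g (Quot.mk _ x))
          (fun x => Γ.shortResistance r e p x - Γ.shortResistance r e s x)
        = Γ.energy (fun x => g (Quot.mk _ x)) (fun x => r p x - r s x)
          + (Γ.edgePotential r e p - Γ.edgePotential r e s) / (2 * r (Γ.src e) (Γ.tgt e))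
            * Γ.energy (fun x => g (Quot.mk _ x)) (Γ.edgePotential r e) := by
      simp only [energy, Finset.mul_sum, ← Finset.sum_add_distrib, shortResistance]
      refine Finset.sum_congr rfl fun f _ => ?_
      ring
    refine h1.trans ?_
    rw [h2, hr.energy_sub, hr.energy_edgePotential, hg]
    ring

/-! ### Summation over all contractions -/

variable [Finite V] (hΓ : Γ.Connected)
include hΓ

theorem weight_mul_contract_edgeSum {e : E} {r' : Γ.ContractVertex e → Γ.ContractVertex e → ℝ}
    (he : r (Γ.src e) (Γ.tgt e) ≠ 0)
    (h : ∀ x y, r' (Quot.mk _ x) (Quot.mk _ y) = Γ.shortResistance r e x y) :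
    Γ.weight e * (Γ.contract e).edgeSum r'
      = r (Γ.src e) (Γ.tgt e) / Γ.length e * Γ.edgeSum r
        - ∑ f, Γ.halfDrop r f e ^ 2 / Γ.length e := by
  have hs : (Γ.contract e).edgeSum r'
      = ∑ f, Γ.shortResistance r e (Γ.src f) (Γ.tgt f) := by
    -- The contracted edge has new resistance 0, so the sum may run over all edges.
    have h0 : Γ.shortResistance r e (Γ.src e) (Γ.tgt e) = 0 := by
      rw [hr.shortResistance_src he]; simp [shortResistance, hr.self]
    rw [Fintype.sum_eq_add_sum_subtype_ne _ e, h0, zero_add]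
    simp only [edgeSum, EdgeMetricGraph.contract, h]
  have hl := (Γ.length_pos e).ne'
  rw [hs, hr.weight_eq hΓ, edgeSum, Finset.mul_sum, Finset.mul_sum, ← Finset.sum_sub_distrib]
  refine Finset.sum_congr rfl fun f _ => ?_
  rw [shortResistance_edge, hr.halfDrop_comm]
  field_simp

/-- Squares are expanded so that only the two mixed sums stay unevaluated: in 3P the mean-square
identity costs 3r_e and the cubic one returns r_e, whence −2 r_e²/L_e. -/
theorem weight_mul_contract_yInv (o : V) (e : E) (q : Γ.ContractVertex e) :
    Γ.weight e * (Γ.contract e).yInv q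
      = 1 / 4 * (r (Γ.src e) (Γ.tgt e) / Γ.length e * (Γ.edgeSqSum r + 3 * Γ.pointEnergy r o)
        - 2 * (r (Γ.src e) (Γ.tgt e) ^ 2 / Γ.length e)
        - 2 * ∑ f, Γ.halfDrop r f e ^ 2 / Γ.length e * (r (Γ.src f) (Γ.tgt f) / Γ.length f)
        - 6 * ∑ f, Γ.halfDrop r e f * Γ.edgeMean r f e * Γ.edgeMean r e f
            / Γ.length f / Γ.length e) := by
  -- For a self-loop both sides are 0.
  by_cases he : r (Γ.src e) (Γ.tgt e) = 0
  · simp only [hr.weight_eq hΓ, hr.halfDrop_comm _ e, hr.halfDrop_eq_zero he, he]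
    simp
  have hl := (Γ.length_pos e).ne'
  obtain ⟨r', hr', h⟩ := hr.contract he
  have hB : (Γ.contract e).edgeSqSum r'
      = ∑ f, Γ.shortResistance r e (Γ.src f) (Γ.tgt f) ^ 2 / Γ.length f := by
    have h0 : Γ.shortResistance r e (Γ.src e) (Γ.tgt e) = 0 := by
      rw [hr.shortResistance_src he]; simp [shortResistance, hr.self]
    rw [Fintype.sum_eq_add_sum_subtype_ne _ e, h0]
    simp [edgeSqSum, EdgeMetricGraph.contract, h]
  have hC : (Γ.contract e).pointEnergy r' (Quot.mk _ (Γ.src e))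
      = ∑ f, (Γ.shortResistance r e (Γ.src f) (Γ.src e)
        - Γ.shortResistance r e (Γ.tgt f) (Γ.src e)) ^ 2 / Γ.length f := by
    rw [Fintype.sum_eq_add_sum_subtype_ne _ e, hr.shortResistance_src he]
    simp [pointEnergy, EdgeMetricGraph.contract, h]
  -- The base vertex is moved to the merged vertex, where `shortResistance_sub` has a simple form.
  rw [hr.weight_eq hΓ, hr'.yInv_eq (hΓ.contract e),
    hr'.pointEnergy_eq q (Quot.mk _ (Γ.src e)), hB, hC]
  simp only [shortResistance_edge, hr.shortResistance_sub e _ he, hr.halfDrop_comm _ e]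
  have hcube := hr.sum_halfDrop_cube e
  have hmean := hr.sum_edgeMean_sq e o
  set ρ := r (Γ.src e) (Γ.tgt e) with hρ
  have key : ∑ f, (r (Γ.src f) (Γ.tgt f) - Γ.halfDrop r e f ^ 2 / ρ) ^ 2 / Γ.length f
      + 3 * ∑ f, (Γ.edgeMean r f e - Γ.halfDrop r e f * Γ.edgeMean r e f / ρ) ^ 2 / Γ.length f
      = Γ.edgeSqSum r + 3 * ∑ f, Γ.edgeMean r f e ^ 2 / Γ.length f
        + 1 / ρ ^ 2 * ∑ f, (Γ.halfDrop r e f ^ 4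
          + 3 * Γ.halfDrop r e f ^ 2 * Γ.edgeMean r e f ^ 2) / Γ.length f
        - Γ.length e / ρ * (2 * ∑ f, Γ.halfDrop r e f ^ 2 / Γ.length e
            * (r (Γ.src f) (Γ.tgt f) / Γ.length f)
        + 6 * ∑ f, Γ.halfDrop r e f * Γ.edgeMean r f e * Γ.edgeMean r e f
            / Γ.length f / Γ.length e) := by
    simp only [edgeSqSum, Finset.mul_sum, ← Finset.sum_add_distrib, ← Finset.sum_sub_distrib]
    refine Finset.sum_congr rfl fun f _ => ?_
    have hf := (Γ.length_pos f).ne'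
    field_simp
    ring
  rw [key, hcube, hmean]
  field_simp
  ring

/-- Up to the factor 1/4 the total is (v − 1)(B + 3P) − 2B − 2B − 3(P − B) = (v − 2)(B + 3P). -/
theorem sum_weight_mul_contract_yInv (p : V) (q : ∀ e : E, Γ.ContractVertex e) :
    ∑ e, Γ.weight e * (Γ.contract e).yInv (q e) = ((Nat.card V : ℝ) - 2) * Γ.yInv p := by
  have := hΓ.1
  have hX : ∑ e, ∑ f, Γ.halfDrop r f e ^ 2 / Γ.length e * (r (Γ.src f) (Γ.tgt f) / Γ.length f)
      = Γ.edgeSqSum r := by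
    rw [Finset.sum_comm]
    simp only [← Finset.sum_mul, hr.sum_halfDrop_sq, edgeSqSum]
    exact Finset.sum_congr rfl fun f _ => by ring
  simp only [hr.weight_mul_contract_yInv hΓ p]
  rw [← Finset.mul_sum]
  simp only [Finset.sum_sub_distrib, ← Finset.mul_sum]
  rw [← Finset.sum_mul, hr.foster, hX, hr.sum_halfDrop_mul_edgeMean p, hr.yInv_eq hΓ]
  rw [← edgeSqSum]
  ring

/-- Foster gives (v − 1) Σ r_f, and the corrections Σ_e d_fe²/L_e = r_f take away one Σ r_f. -/
theorem sum_weight_mul_contract_add (q : ∀ e : E, Γ.ContractVertex e) :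
    ∑ e, Γ.weight e * ((Γ.contract e).xInv (q e) + (Γ.contract e).yInv (q e))
      = ((Nat.card V : ℝ) - 2) * Γ.edgeSum r := by
  have := hΓ.1
  have h (e : E) : Γ.weight e * ((Γ.contract e).xInv (q e) + (Γ.contract e).yInv (q e))
      = r (Γ.src e) (Γ.tgt e) / Γ.length e * Γ.edgeSum r
        - ∑ f, Γ.halfDrop r f e ^ 2 / Γ.length e := by
    by_cases he : r (Γ.src e) (Γ.tgt e) = 0
    · simp [hr.weight_eq hΓ, hr.halfDrop_comm _ e, hr.halfDrop_eq_zero he, he]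
    · obtain ⟨r', hr', h⟩ := hr.contract he
      rw [hr'.xInv_eq (hΓ.contract e), sub_add_cancel, hr.weight_mul_contract_edgeSum hΓ he h]
  simp only [h, Finset.sum_sub_distrib]
  rw [Finset.sum_comm, ← Finset.sum_mul, hr.foster]
  simp only [hr.sum_halfDrop_sq]
  rw [← edgeSum]
  ring

end IsResistance

end EdgeMetricGraph

/-- Contraction identities for `x` and `y` on an arbitrary metrized graph (bridges, self-loops and
multiple edges allowed), for every choice of the base vertices used to compute the invariants. -/
theorem mainTheorem3 {V : Type*} {E : Type*} [Finite V] [Fintype E] [DecidableEq E]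
    (Γ : EdgeMetricGraph V E) (hΓ : Γ.Connected) (p : V) (q : ∀ e : E, Γ.ContractVertex e) :
    ((Nat.card V : ℝ) - 2) * Γ.xInv p = ∑ e, Γ.weight e * (Γ.contract e).xInv (q e) ∧
    ((Nat.card V : ℝ) - 2) * Γ.yInv p = ∑ e, Γ.weight e * (Γ.contract e).yInv (q e) := by
  obtain ⟨r, hr⟩ := hΓ.exists_isResistance
  have hy := hr.sum_weight_mul_contract_yInv hΓ p q
  have hxy := hr.sum_weight_mul_contract_add hΓ q
  simp only [mul_add, Finset.sum_add_distrib] at hxy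
  refine ⟨?_, hy.symm⟩
  rw [hr.xInv_eq hΓ]
  linarith
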